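/- A *quantale* is here a complete lattice $A$ (with least element $0$ and greatest element $1$) carrying an associative commutative multiplication which distributes over arbitrary joins and for which $1$ is the unit. Let $K(A)$ be the set of compact elements of $A$. The quantale $A$ is *coherent* if every element is a join of compact elements, $1\in K(A)$, and $K(A)$ is closed under multiplication. For $a\in A$ put $a^{\perp}=\bigvee\{x\in A : ax=0\}$. An element $p\neq 1$ is *$m$-prime* if $ab\le p$ implies $a\le p$ or $b\le p$, for all $a,b\in A$; $\mathrm{Spec}(A)$ is the set of $m$-prime elements, $\mathrm{Min}(A)$ the set of minimal elements of $\mathrm{Spec}(A)$, and $V(a)=\{p\in \mathrm{Spec}(A): a\le p\}$. The quantale $A$ is *semiprime* if $\bigwedge \mathrm{Spec}(A)=0$. Let $B(A)$ be the set of complemented elements of the lattice $A$; for $e\in B(A)$ the complement is $\neg e=e^{\perp}$. The spectral topology on $\mathrm{Spec}(A)$ is the one whose closed sets are the sets $V(a)$, $a\in A$; the flat topology on $\mathrm{Spec}(A)$ has as a basis of open sets the complements of the compact open sets of the spectral topology. $\mathrm{Min}_F(A)$ is the set $\mathrm{Min}(A)$ with the topology induced by the flat topology. A *Boolean space* is a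 compact Hausdorff totally disconnected space. - $A$ is *purified* if for all distinct $p,q\in \mathrm{Min}(A)$ there is $e\in B(A)$ with $e\le p$ and $\neg e\le q$. - $A$ is an *$mp$-quantale* if for every $p\in \mathrm{Spec}(A)$ there is a unique $q\in \mathrm{Min}(A)$ with $q\le p$. - An element is *regular* if it is a join of complemented elements. The Pierce spectrum $\mathrm{Sp}(A)$ is the set of maximal elements of the set of regular elements $\ne 1$. - An element $a$ is *pure* if $a\vee c^{\perp}=1$ for every $c\in K(A)$ with $c\le a$. **Theorem 7.5.** For a semiprime coherent quantale $A$ the following are equivalent: 1. $A$ is purified; 2. $A$ is an $mp$-quantale and $\mathrm{Min}_F(A)$ is totally separated; 3. $A$ is an $mp$-quantale and $\mathrm{Min}_F(A)$ is totally disconnected; 4. $A$ is an $mp$-quantale and $\mathrm{Min}_F(A)$ is a Boolean space; 5. the family $(V(e)\cap \mathrm{Min}(A))_{e\in B(A)}$ is a basis of open sets for $\mathrm{Min}_F(A)$; 6. every minimal $m$-prime element of $A$ is regular; 7. $\mathrm{Min}(A)=\mathrm{Sp}(A)$; 8. $A$ is an $mp$-quantale and every pure element of $A$ is regular. -/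

import Mathlib

/-!
Commutative integral quantales are modelled as `[CommMonoid A] [CompleteLattice A] [IsQuantale A]`
together with `Quantale.IsIntegral A`, which says that the unit of the monoid is the top element.
-/

namespace Quantale

/-- A quantale is integral if its top element is a unit for the multiplication. -/
class IsIntegral (A : Type*) [CommMonoid A] [CompleteLattice A] : Prop where
  one_eq_top : (1 : A) = ⊤

variable {A : Type*} [CommMonoid A] [CompleteLattice A] [IsQuantale A]

variable (A) in
/-- A coherent quantale: every element is a join of compact elements, the top element is compact
and the compact elements are closed under multiplication. -/
structure IsCoherent : Prop where
  algebraic : ∀ a : A, ∃ X : Set A, (∀ c ∈ X, IsCompactElement c) ∧ sSup X = a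
  top_compact : IsCompactElement (⊤ : A)
  mul_compact : ∀ c d : A, IsCompactElement c → IsCompactElement d → IsCompactElement (c * d)

/-- The negation `a^⊥`, the join of all `x` with `a * x = 0`. -/
def neg (a : A) : A := sSup {x | a * x = ⊥}

/-- `m`-prime elements. -/
def IsMPrime (p : A) : Prop := p ≠ ⊤ ∧ ∀ a b : A, a * b ≤ p → a ≤ p ∨ b ≤ p

/-- The radical: the meet of all `m`-prime elements above `a`. -/
def radical (a : A) : A := sInf {p | IsMPrime p ∧ a ≤ p}

variable (A) in
/-- A quantale is semiprime if the radical of `0` is `0`. -/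
def IsSemiprime : Prop := radical (⊥ : A) = ⊥

variable (A) in
/-- The Boolean center `B(A)`: the complemented elements. -/
def booleanCenter : Set A := {e | IsComplemented e}

/-- Regular elements: the joins of complemented elements. -/
def IsRegularElement (a : A) : Prop := ∃ E : Set A, E ⊆ booleanCenter A ∧ a = sSup E

variable (A) in
/-- The Pierce spectrum `Sp(A)`: the maximal elements among the proper regular elements. -/
def pierceSpectrum : Set A := {a | Maximal (fun x : A => x ≠ ⊤ ∧ IsRegularElement x) a}

/-- Pure elements. -/
def IsPure (a : A) : Prop := ∀ c : A, IsCompactElement c → c ≤ a → a ⊔ neg c = ⊤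

variable (A) in
/-- `Spec(A)`. -/
def Spec : Set A := {p | IsMPrime p}

variable (A) in
/-- `Min(A)`: the minimal elements of `Spec(A)`. -/
def minSpec : Set A := {p | Minimal IsMPrime p}

variable (A) in
/-- `A` is an `mp`-quantale if every `m`-prime element lies above a unique minimal one. -/
def IsMp : Prop := ∀ p ∈ Spec A, ∃! q, q ∈ minSpec A ∧ q ≤ p

variable (A) in
/-- `A` is purified if any two distinct minimal `m`-prime elements are separated by a
complemented element. -/
def IsPurified : Prop :=
  ∀ p ∈ minSpec A, ∀ q ∈ minSpec A, p ≠ q → ∃ e ∈ booleanCenter A, e ≤ p ∧ neg e ≤ q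

/-- `V(a)`, as a set of `m`-prime elements. -/
def V (a : A) : Set (Spec A) := {p | a ≤ p.1}

theorem mul_le_inf [IsIntegral A] (a b : A) : a * b ≤ a ⊓ b := by
  refine le_inf ?_ ?_
  · calc a * b ≤ a * 1 := mul_le_mul_right (IsIntegral.one_eq_top (A := A) ▸ le_top) a
      _ = a := mul_one a
  · calc a * b ≤ 1 * b := mul_le_mul_left (IsIntegral.one_eq_top (A := A) ▸ le_top) b
      _ = b := one_mul b

variable (A) in
/-- The spectral (Zariski) topology on `Spec(A)`: the closed sets are exactly the `V(a)`. -/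
abbrev zariskiTopology [IsIntegral A] : TopologicalSpace (Spec A) :=
  TopologicalSpace.ofClosed (Set.range (V (A := A)))
    ⟨⊤, Set.eq_empty_iff_forall_notMem.2 fun p hp => p.2.1 (top_le_iff.1 hp)⟩
    (fun S hS => ⟨sSup {a | V a ∈ S}, by
      ext p
      simp only [V, Set.mem_sInter, Set.mem_ofPred_eq, sSup_le_iff]
      constructor
      · intro h t ht
        obtain ⟨a, rfl⟩ := hS ht
        exact h a ht
      · intro h a ha
        exact h _ ha⟩)
    (by
      rintro _ ⟨a, rfl⟩ _ ⟨b, rfl⟩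
      refine ⟨a * b, ?_⟩
      ext p
      constructor
      · intro h
        exact p.2.2 a b h
      · rintro (h | h)
        · exact ((mul_le_inf a b).trans inf_le_left).trans h
        · exact ((mul_le_inf a b).trans inf_le_right).trans h)

variable (A) in
/-- The flat topology on `Spec(A)`: it has the complements of the compact open
subsets of the spectral topology as a basis of open sets. -/
abbrev flatTopology [IsIntegral A] : TopologicalSpace (Spec A) :=
  TopologicalSpace.generateFrom
    {U | @IsCompact _ (zariskiTopology A) Uᶜ ∧ @IsOpen _ (zariskiTopology A) Uᶜ}

variable (A) in
/-- The set `Min(A)`, as a type carrying the flat topology. -/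
def MinF : Type _ := {p : A // p ∈ minSpec A}

/-- A minimal `m`-prime element, as a point of `Spec(A)`. -/
def MinF.toSpec (p : MinF A) : Spec A := ⟨p.1, p.2.1⟩

/-- The topology of `Min_F(A)`: the restriction of the flat topology of `Spec(A)`. -/
instance [IsIntegral A] : TopologicalSpace (MinF A) :=
  TopologicalSpace.induced MinF.toSpec (flatTopology A)

/-- A Boolean space: compact, Hausdorff and totally disconnected. -/
def IsBooleanSpace (X : Type*) [TopologicalSpace X] : Prop :=
  CompactSpace X ∧ T2Space X ∧ TotallyDisconnectedSpace X

end Quantale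

/-!
Prime separation (a submonoid of compact elements none of which lies below `a` is avoided by an
`m`-prime above `a`) drives every step. It shows that `Min_F(A)` is always compact, and that
`c^⊥ ≤ m` with `c` compact forces a minimal `m`-prime below `m` to avoid `c`, so that the minimal
`m`-primes of a semiprime `mp`-quantale are pure. In an `mp`-quantale distinct minimal `m`-primes
are comaximal, hence `Min_F(A)` is Hausdorff and a clopen set `U` and its complement have
comaximal kernels; if `A` is semiprime these kernels are complements of each other, so that `U` is
cut out by a complemented element. Conversely, regularity of the minimal `m`-primes is transferred
to a pure element `a` locally: `c ≤ a` lies below the regular part of `a` as soon as, around every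
`m`-prime, some multiple of `c` does.
-/

namespace IntegralQuantale

open Quantale

section CompleteLattice

variable {A : Type*} [CompleteLattice A]

theorem exists_compact_le_of_le_sup [IsCompactlyGenerated A] {k a b : A}
    (hk : IsCompactElement k) (h : k ≤ a ⊔ b) :
    ∃ c, IsCompactElement c ∧ c ≤ a ∧ k ≤ c ⊔ b := by
  have hsup : k ≤ sSup (insert b {c | IsCompactElement c ∧ c ≤ a}) := by
    rwa [sSup_insert, sSup_compact_le_eq, sup_comm]
  obtain ⟨t, ht, hkt⟩ :=
    (CompleteLattice.isCompactElement_iff_exists_le_sSup_of_le_sSup A k).1 hk _ hsup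
  classical
  have hmem : ∀ c ∈ t.erase b, IsCompactElement c ∧ c ≤ a := fun c hc =>
    (ht (Finset.mem_of_mem_erase hc)).resolve_left (Finset.ne_of_mem_erase hc)
  refine ⟨(t.erase b).sup id,
    CompleteLattice.isCompactElement_finsetSup _ fun c hc => (hmem c hc).1,
    Finset.sup_le fun c hc => (hmem c hc).2, hkt.trans (Finset.sup_le fun c hc => ?_)⟩
  rcases eq_or_ne c b with rfl | hcb
  · exact le_sup_right
  · exact le_sup_of_le_left (Finset.le_sup (f := id) (Finset.mem_erase.2 ⟨hcb, hc⟩))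

theorem _root_.Quantale.IsRegularElement.sup {a b : A} (ha : IsRegularElement a)
    (hb : IsRegularElement b) : IsRegularElement (a ⊔ b) := by
  obtain ⟨E, hE, rfl⟩ := ha
  obtain ⟨F, hF, rfl⟩ := hb
  exact ⟨E ∪ F, Set.union_subset hE hF, sSup_union.symm⟩

/-- The regular part of `a`, the largest regular element below `a`. -/
def regularPart (a : A) : A := sSup {e | e ∈ booleanCenter A ∧ e ≤ a}

theorem regularPart_le (a : A) : regularPart a ≤ a := sSup_le fun _ he => he.2

theorem le_regularPart {a e : A} (he : e ∈ booleanCenter A) (h : e ≤ a) : e ≤ regularPart a :=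
  le_sSup ⟨he, h⟩

theorem isRegularElement_of_le_regularPart {a : A} (h : a ≤ regularPart a) :
    IsRegularElement a :=
  ⟨_, fun _ he => he.1, h.antisymm (regularPart_le a)⟩

end CompleteLattice

section MPrime

variable {A : Type*} [CommMonoid A] [CompleteLattice A]

theorem _root_.Quantale.IsCoherent.isCompactlyGenerated (hcoh : IsCoherent A) :
    IsCompactlyGenerated A :=
  ⟨hcoh.algebraic⟩

theorem _root_.Quantale.IsCoherent.isCoatomic (hcoh : IsCoherent A) : IsCoatomic A :=
  CompleteLattice.coatomic_of_top_compact hcoh.top_compact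

theorem _root_.Quantale.IsMPrime.sup_ne_top {p a b : A} (hp : IsMPrime p) (ha : a ≤ p)
    (hb : b ≤ p) : a ⊔ b ≠ ⊤ :=
  fun h => hp.1 (top_le_iff.1 (h ▸ sup_le ha hb))

theorem isMPrime_sInf_of_isChain {c : Set A} (hne : c.Nonempty) (hchain : IsChain (· ≤ ·) c)
    (hc : ∀ p ∈ c, IsMPrime p) : IsMPrime (sInf c) := by
  obtain ⟨p, hp⟩ := hne
  refine ⟨fun h => (hc p hp).1 (top_le_iff.1 (h.ge.trans (sInf_le hp))), fun a b hab => ?_⟩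
  by_contra! hcon
  simp only [le_sInf_iff, not_forall] at hcon
  obtain ⟨⟨x, hx, hax⟩, ⟨y, hy, hby⟩⟩ := hcon
  rcases hchain.total hx hy with hxy | hyx
  · exact ((hc x hx).2 a b (hab.trans (sInf_le hx))).elim hax fun hbx => hby (hbx.trans hxy)
  · exact ((hc y hy).2 a b (hab.trans (sInf_le hy))).elim (fun hay => hax (hay.trans hyx)) hby

theorem _root_.Quantale.IsMPrime.exists_minSpec_le {p : A} (hp : IsMPrime p) :
    ∃ q ∈ minSpec A, q ≤ p := by
  obtain ⟨q, hqp, hq⟩ := @zorn_le_nonempty₀ Aᵒᵈ _ {q : A | IsMPrime q}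
    (fun c hc hchain y hy =>
      ⟨sInf (α := A) c, isMPrime_sInf_of_isChain ⟨y, hy⟩ hchain.symm hc,
        fun z hz => sInf_le (α := A) hz⟩) p hp
  exact ⟨q, hq, hqp⟩

theorem _root_.Quantale.IsSemiprime.eq_bot_of_forall_le (hsemi : IsSemiprime A) {a : A}
    (h : ∀ p ∈ minSpec A, a ≤ p) : a = ⊥ := by
  refine le_bot_iff.1 (le_trans (le_sInf fun p hp => ?_) hsemi.le)
  obtain ⟨q, hq, hqp⟩ := hp.1.exists_minSpec_le
  exact (h q hq).trans hqp

theorem mem_V {a : A} {p : Spec A} : p ∈ V a ↔ a ≤ p.1 := Iff.rfl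

theorem V_anti {a b : A} (h : a ≤ b) : V b ⊆ V a := fun _ hp => h.trans hp

theorem V_iSup {ι : Sort*} (a : ι → A) : V (⨆ i, a i) = ⋂ i, V (a i) := by
  ext p
  simp only [mem_V, Set.mem_iInter, iSup_le_iff]

theorem le_radical_of_V_subset {a c : A} (h : V a ⊆ V c) : c ≤ radical a :=
  le_sInf fun p hp => h (show (⟨p, hp.1⟩ : Spec A) ∈ V a from hp.2)

/-- The trace `V(a) ∩ Min(A)` of `V(a)` on the space of minimal `m`-primes. -/
def minV (a : A) : Set (MinF A) := MinF.toSpec ⁻¹' V a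

/-- The kernel of a set of minimal `m`-primes, in the sense of the hull-kernel correspondence:
the meet of its members. -/
def kernel (U : Set (MinF A)) : A := ⨅ q ∈ U, q.1

theorem kernel_le {U : Set (MinF A)} {p : MinF A} (hp : p ∈ U) : kernel U ≤ p.1 :=
  iInf₂_le p hp

theorem _root_.Quantale.IsSemiprime.kernel_inf_kernel_compl (hsemi : IsSemiprime A)
    (U : Set (MinF A)) : kernel U ⊓ kernel Uᶜ = ⊥ := by
  refine hsemi.eq_bot_of_forall_le fun p hp => ?_
  by_cases h : (⟨p, hp⟩ : MinF A) ∈ U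
  · exact inf_le_left.trans (kernel_le h)
  · exact inf_le_right.trans (kernel_le (p := ⟨p, hp⟩) h)

end MPrime

section Integral

variable {A : Type*} [CommMonoid A] [CompleteLattice A] [IsIntegral A]

theorem mul_top (a : A) : a * ⊤ = a := by rw [← IsIntegral.one_eq_top, mul_one]

/-- The submonoid `K(A)` of compact elements of a coherent quantale. -/
def _root_.Quantale.IsCoherent.compactSubmonoid (hcoh : IsCoherent A) : Submonoid A where
  carrier := {c | IsCompactElement c}
  mul_mem' hc hd := hcoh.mul_compact _ _ hc hd
  one_mem' := (IsIntegral.one_eq_top (A := A)).symm ▸ hcoh.top_compact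

/-- The submonoid of elements not below an `m`-prime, the analogue of the complement of a prime
ideal. -/
def _root_.Quantale.IsMPrime.primeCompl {p : A} (hp : IsMPrime p) : Submonoid A where
  carrier := {a | ¬ a ≤ p}
  mul_mem' ha hb h := (hp.2 _ _ h).elim ha hb
  one_mem' h := hp.1 (top_le_iff.1 (IsIntegral.one_eq_top (A := A) ▸ h))

theorem _root_.Quantale.IsMPrime.le_of_pow_le {p a : A} (hp : IsMPrime p) {n : ℕ}
    (h : a ^ n ≤ p) : a ≤ p := by
  by_contra ha
  exact pow_mem (S := hp.primeCompl) ha n h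

theorem minV_one : minV (1 : A) = ∅ :=
  Set.eq_empty_of_forall_notMem fun p => p.2.1.primeCompl.one_mem

end Integral

section Quantale

variable {A : Type*} [CommMonoid A] [CompleteLattice A] [IsQuantale A]

theorem le_neg_iff {a x : A} : x ≤ neg a ↔ a * x = ⊥ := by
  rw [← le_bot_iff, ← rightMulResiduation_le_iff_mul_le]
  simp only [neg, rightMulResiduation, le_bot_iff]

theorem mul_neg_eq_bot (a : A) : a * neg a = ⊥ := le_neg_iff.1 le_rfl

theorem _root_.Quantale.IsMPrime.neg_le {p a : A} (hp : IsMPrime p) (h : ¬ a ≤ p) : neg a ≤ p :=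
  (hp.2 a (neg a) ((mul_neg_eq_bot a).trans_le bot_le)).resolve_left h

theorem isPurified_of_isRegularElement (hreg : ∀ p ∈ minSpec A, IsRegularElement p) :
    IsPurified A := by
  intro p hp q hq hne
  obtain ⟨E, hE, hpE⟩ := hreg p hp
  by_contra! hcon
  have hpq : p ≤ q := hpE.le.trans <| sSup_le fun e he => by
    by_contra heq
    exact hcon e (hE he) ((le_sSup he).trans hpE.ge) (hq.1.neg_le heq)
  exact hne (hpq.antisymm (hq.2 hp.1 hpq))

end Quantale

variable {A : Type*} [CommMonoid A] [CompleteLattice A] [IsQuantale A] [IsIntegral A]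

section Complemented

theorem mul_le_left (a b : A) : a * b ≤ a := (mul_le_inf a b).trans inf_le_left

theorem mul_le_right (a b : A) : a * b ≤ b := (mul_le_inf a b).trans inf_le_right

theorem sup_mul_sup_le (x a b : A) : (x ⊔ a) * (x ⊔ b) ≤ x ⊔ a * b := by
  rw [sup_mul_distrib, mul_sup_distrib (x := a)]
  exact sup_le ((mul_le_left _ _).trans le_sup_left)
    (sup_le ((mul_le_right _ _).trans le_sup_left) le_sup_right)

theorem sup_mul_eq_top {x a b : A} (ha : x ⊔ a = ⊤) (hb : x ⊔ b = ⊤) : x ⊔ a * b = ⊤ := by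
  simpa only [ha, hb, mul_top, top_le_iff] using sup_mul_sup_le x a b

theorem le_of_mul_le_of_sup_eq_top {x e f y : A} (h : e ⊔ f = ⊤) (he : x * e ≤ y)
    (hf : x * f ≤ y) : x ≤ y := by
  rw [← mul_top x, ← h, mul_sup_distrib]
  exact sup_le he hf

theorem mul_eq_inf_of_sup_eq_top {e f : A} (h : e ⊔ f = ⊤) : e * f = e ⊓ f := by
  refine (mul_le_inf e f).antisymm (le_of_mul_le_of_sup_eq_top h ?_ ?_)
  · rw [mul_comm]
    exact mul_le_mul_right inf_le_right e
  · exact mul_le_mul_left inf_le_left f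

theorem isCompl_iff_mul_eq_bot_and_sup_eq_top {e f : A} :
    IsCompl e f ↔ e * f = ⊥ ∧ e ⊔ f = ⊤ := by
  rw [isCompl_iff, disjoint_iff, codisjoint_iff]
  exact and_congr_left fun h => by rw [mul_eq_inf_of_sup_eq_top h]

theorem isCompl_neg {e : A} (he : e ∈ booleanCenter A) : IsCompl e (neg e) := by
  obtain ⟨f, hf⟩ := he
  have hfe : f ≤ neg e := le_neg_iff.2 (isCompl_iff_mul_eq_bot_and_sup_eq_top.1 hf).1
  exact isCompl_iff_mul_eq_bot_and_sup_eq_top.2 ⟨mul_neg_eq_bot e,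
    top_le_iff.1 (hf.sup_eq_top.ge.trans (sup_le_sup_left hfe e))⟩

theorem neg_mem_booleanCenter {e : A} (he : e ∈ booleanCenter A) : neg e ∈ booleanCenter A :=
  ⟨e, (isCompl_neg he).symm⟩

theorem mul_neg_eq_bot_iff_le {a e : A} (he : e ∈ booleanCenter A) :
    a * neg e = ⊥ ↔ a ≤ e := by
  refine ⟨fun h => ?_, fun h => le_bot_iff.1 ?_⟩
  · exact le_of_mul_le_of_sup_eq_top (isCompl_neg he).sup_eq_top (mul_le_right a e)
      (h.trans_le bot_le)
  · exact (mul_le_mul_left h _).trans (mul_neg_eq_bot e).le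

theorem neg_le_iff_sup_eq_top {a e : A} (he : e ∈ booleanCenter A) :
    neg e ≤ a ↔ e ⊔ a = ⊤ := by
  refine ⟨fun h => ?_, fun h => le_of_mul_le_of_sup_eq_top h ?_ (mul_le_right _ _)⟩
  · exact top_le_iff.1 ((isCompl_neg he).sup_eq_top.ge.trans (sup_le_sup_left h e))
  · rw [mul_comm, mul_neg_eq_bot]
    exact bot_le

theorem _root_.Quantale.IsMPrime.neg_le_iff {p e : A} (hp : IsMPrime p)
    (he : e ∈ booleanCenter A) : neg e ≤ p ↔ ¬ e ≤ p :=
  ⟨fun hn h => hp.sup_ne_top h hn (isCompl_neg he).sup_eq_top, hp.neg_le⟩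

theorem sup_mem_booleanCenter {e f : A} (he : e ∈ booleanCenter A) (hf : f ∈ booleanCenter A) :
    e ⊔ f ∈ booleanCenter A := by
  refine ⟨neg e * neg f, isCompl_iff_mul_eq_bot_and_sup_eq_top.2 ⟨?_, sup_mul_eq_top ?_ ?_⟩⟩
  · rw [sup_mul_distrib, ← mul_assoc, mul_neg_eq_bot, bot_mul, mul_left_comm, mul_neg_eq_bot,
      mul_bot, sup_idem]
  · rw [sup_right_comm, (isCompl_neg he).sup_eq_top, top_sup_eq]
  · rw [sup_assoc, (isCompl_neg hf).sup_eq_top, sup_top_eq]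

theorem _root_.Quantale.IsRegularElement.exists_mem_booleanCenter {a c : A}
    (ha : IsRegularElement a) (hc : IsCompactElement c) (hca : c ≤ a) :
    ∃ e ∈ booleanCenter A, c ≤ e ∧ e ≤ a := by
  obtain ⟨E, hE, rfl⟩ := ha
  obtain ⟨t, ht, hct⟩ :=
    (CompleteLattice.isCompactElement_iff_exists_le_sSup_of_le_sSup A c).1 hc E hca
  refine ⟨t.sup id, ?_, hct, Finset.sup_le fun x hx => le_sSup (ht hx)⟩
  exact Finset.sup_induction (p := (· ∈ booleanCenter A)) ⟨⊤, isCompl_bot_top⟩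
    (fun _ h _ h' => sup_mem_booleanCenter h h') fun x hx => hE (ht hx)

theorem isCompactElement_of_mem_booleanCenter [IsCompactlyGenerated A]
    (htop : IsCompactElement (⊤ : A)) {e : A} (he : e ∈ booleanCenter A) :
    IsCompactElement e := by
  obtain ⟨c, hc, hce, htopc⟩ := exists_compact_le_of_le_sup htop (isCompl_neg he).sup_eq_top.ge
  have hec : e ≤ c := le_of_mul_le_of_sup_eq_top (top_le_iff.1 htopc) (mul_le_right e c)
    ((mul_neg_eq_bot e).trans_le bot_le)
  rwa [hec.antisymm hce]

end Complemented

section PrimeSeparation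

theorem isMPrime_of_maximal_avoiding {S : Submonoid A} {q : A}
    (hq : Maximal (fun x => ∀ s ∈ S, ¬ s ≤ x) q) : IsMPrime q := by
  refine ⟨fun h => hq.1 1 S.one_mem (h ▸ le_top), fun a b hab => ?_⟩
  have exists_le_sup : ∀ x, ¬ x ≤ q → ∃ s ∈ S, s ≤ q ⊔ x := fun x hx => by
    by_contra! h
    exact hx (le_sup_right.trans (hq.2 h le_sup_left))
  by_contra! hcon
  obtain ⟨s, hs, hsa⟩ := exists_le_sup a hcon.1
  obtain ⟨t, ht, htb⟩ := exists_le_sup b hcon.2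
  refine hq.1 (s * t) (S.mul_mem hs ht) ?_
  calc s * t ≤ (q ⊔ a) * (q ⊔ b) := mul_le_mul' hsa htb
    _ ≤ q ⊔ a * b := sup_mul_sup_le q a b
    _ ≤ q := sup_le le_rfl hab

theorem exists_le_isMPrime_avoiding {S : Submonoid A} (hS : ∀ s ∈ S, IsCompactElement s) {a : A}
    (ha : ∀ s ∈ S, ¬ s ≤ a) : ∃ q, IsMPrime q ∧ a ≤ q ∧ ∀ s ∈ S, ¬ s ≤ q := by
  obtain ⟨q, haq, hq⟩ := zorn_le_nonempty₀ {x : A | ∀ s ∈ S, ¬ s ≤ x}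
    (fun c hc hchain y hy => by
      refine ⟨sSup c, fun s hs hle => ?_, fun z hz => le_sSup hz⟩
      obtain ⟨x, hx, hsx⟩ :=
        hS s hs c (sSup c) ⟨y, hy⟩ hchain.directedOn (isLUB_sSup c) hle
      exact hc hx s hs hsx) a ha
  exact ⟨q, isMPrime_of_maximal_avoiding hq, haq, hq.1⟩

theorem isMPrime_of_isCoatom {m : A} (hm : IsCoatom m) : IsMPrime m := by
  refine ⟨hm.1, fun a b hab => ?_⟩
  by_contra! hcon
  have hsup : m ⊔ a * b = ⊤ := sup_mul_eq_top
    (hm.2 _ (left_lt_sup.2 hcon.1)) (hm.2 _ (left_lt_sup.2 hcon.2))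
  exact hm.1 (by rwa [sup_eq_left.2 hab] at hsup)

theorem exists_le_isMPrime [IsCoatomic A] {a : A} (ha : a ≠ ⊤) : ∃ m, IsMPrime m ∧ a ≤ m := by
  obtain ⟨m, hm, ham⟩ := (eq_top_or_exists_le_coatom a).resolve_left ha
  exact ⟨m, isMPrime_of_isCoatom hm, ham⟩

theorem sup_eq_top_of_forall_isMPrime [IsCoatomic A] {a b : A}
    (h : ∀ m, IsMPrime m → a ≤ m → ¬ b ≤ m) : a ⊔ b = ⊤ := by
  by_contra hne
  obtain ⟨m, hm, hle⟩ := exists_le_isMPrime hne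
  exact h m hm (le_sup_left.trans hle) (le_sup_right.trans hle)

theorem le_of_forall_isMPrime_exists_mul_le [IsCoatomic A] {c r : A}
    (h : ∀ m, IsMPrime m → ∃ g, ¬ g ≤ m ∧ c * g ≤ r) : c ≤ r := by
  have htop : c ⇨ᵣ r = ⊤ := by
    by_contra hne
    obtain ⟨m, hm, hle⟩ := exists_le_isMPrime hne
    obtain ⟨g, hgm, hg⟩ := h m hm
    exact hgm ((rightMulResiduation_le_iff_mul_le.2 hg).trans hle)
  rw [← mul_top c]
  exact rightMulResiduation_le_iff_mul_le.1 htop.ge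

theorem _root_.Quantale.IsCoherent.exists_pow_le_of_le_radical (hcoh : IsCoherent A) {a c : A}
    (hc : IsCompactElement c) (h : c ≤ radical a) : ∃ n : ℕ, c ^ n ≤ a := by
  by_contra! hcon
  obtain ⟨q, hq, haq, hqS⟩ := exists_le_isMPrime_avoiding (S := Submonoid.powers c)
    (Submonoid.powers_le (P := hcoh.compactSubmonoid).2 hc)
    (by rintro _ ⟨n, rfl⟩; exact hcon n)
  exact hqS c (Submonoid.mem_powers c) (h.trans (sInf_le ⟨hq, haq⟩))

theorem _root_.Quantale.IsCoherent.exists_minSpec_le_not_ge (hcoh : IsCoherent A) {m c : A}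
    (hm : IsMPrime m) (hc : IsCompactElement c) (h : ∀ d (n : ℕ), d * c ^ n = ⊥ → d ≤ m) :
    ∃ q ∈ minSpec A, q ≤ m ∧ ¬ c ≤ q := by
  have := hcoh.isCompactlyGenerated
  let K := hcoh.compactSubmonoid
  let S : Submonoid A := (K ⊓ hm.primeCompl) ⊔ Submonoid.powers c
  have hSK : S ≤ K := sup_le inf_le_left (Submonoid.powers_le.2 hc)
  have hS : ∀ s ∈ S, ¬ s ≤ ⊥ := fun s hs hbot => by
    obtain ⟨d, hd, _, ⟨n, rfl⟩, rfl⟩ := Submonoid.mem_sup.1 hs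
    exact hd.2 (h d n (le_bot_iff.1 hbot))
  obtain ⟨q, hq, -, hqS⟩ := exists_le_isMPrime_avoiding hSK hS
  obtain ⟨q', hq', hle⟩ := hq.exists_minSpec_le
  refine ⟨q', hq', hle.trans (le_iff_compact_le_imp.2 fun d hd hdq => ?_), fun hcq => ?_⟩
  · by_contra hdm
    exact hqS d (le_sup_left (α := Submonoid A) ⟨hd, hdm⟩) hdq
  · exact hqS c (le_sup_right (α := Submonoid A) (Submonoid.mem_powers c)) (hcq.trans hle)

theorem _root_.Quantale.IsSemiprime.mul_eq_bot_of_mul_pow_eq_bot (hsemi : IsSemiprime A)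
    {d c : A} {n : ℕ} (h : d * c ^ n = ⊥) : c * d = ⊥ :=
  hsemi.eq_bot_of_forall_le fun _ hp =>
    (hp.1.2 d (c ^ n) (h.trans_le bot_le)).elim (mul_le_right c d).trans
      fun hcp => (mul_le_left c d).trans (hp.1.le_of_pow_le hcp)

end PrimeSeparation

section FlatTopology

theorem isOpen_compl_V (a : A) : @IsOpen _ (zariskiTopology A) (V a)ᶜ :=
  ⟨a, (compl_compl _).symm⟩

theorem _root_.Quantale.IsCoherent.isCompact_compl_V (hcoh : IsCoherent A) {c : A}
    (hc : IsCompactElement c) : @IsCompact _ (zariskiTopology A) (V c)ᶜ := by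
  let _ := zariskiTopology A
  refine isCompact_of_finite_subcover fun {ι} U hU hcover => ?_
  choose a ha using (hU : ∀ i, ∃ a : A, V a = (U i)ᶜ)
  obtain rfl : U = fun i => (V (a i))ᶜ := funext fun i => by rw [ha, compl_compl]
  rw [← Set.compl_iInter, Set.compl_subset_compl, ← V_iSup] at hcover
  obtain ⟨n, hn⟩ := hcoh.exists_pow_le_of_le_radical hc (le_radical_of_V_subset hcover)
  obtain ⟨t, ht⟩ := CompleteLattice.IsCompactElement.exists_finset_of_le_iSup A
    (pow_mem (S := hcoh.compactSubmonoid) hc n) a hn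
  refine ⟨t, ?_⟩
  rw [← Set.compl_iInter₂, Set.compl_subset_compl]
  calc ⋂ i ∈ t, V (a i) = V (⨆ i ∈ t, a i) := by simp only [V_iSup]
    _ ⊆ V (c ^ n) := V_anti ht
    _ ⊆ V c := fun p hp => p.2.le_of_pow_le hp

theorem exists_eq_V_of_isCompact_compl [IsCompactlyGenerated A] {U : Set (Spec A)}
    (hcomp : @IsCompact _ (zariskiTopology A) Uᶜ) (hopen : @IsOpen _ (zariskiTopology A) Uᶜ) :
    ∃ c, IsCompactElement c ∧ U = V c := by
  let _ := zariskiTopology A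
  obtain ⟨a, ha⟩ := hopen
  obtain rfl : V a = U := ha.trans (compl_compl U)
  have hV : V a = ⋂ c : {c : A // IsCompactElement c ∧ c ≤ a}, V c.1 := by
    rw [← V_iSup]
    exact congrArg V ((sSup_compact_le_eq a).symm.trans (sSup_eq_iSup' _))
  obtain ⟨t, ht⟩ := hcomp.elim_finite_subcover
    (fun c : {c : A // IsCompactElement c ∧ c ≤ a} => (V c.1)ᶜ)
    (fun c => isOpen_compl_V c.1) (by rw [← Set.compl_iInter, ← hV])
  rw [← Set.compl_iInter₂, Set.compl_subset_compl] at ht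
  refine ⟨t.sup Subtype.val,
    CompleteLattice.isCompactElement_finsetSup t fun c _ => c.2.1, ?_⟩
  refine (V_anti (Finset.sup_le fun c _ => c.2.2)).antisymm (subset_trans ?_ ht)
  simp only [Finset.sup_eq_iSup, V_iSup, subset_rfl]

theorem _root_.Quantale.IsCoherent.flatTopology_eq_generateFrom (hcoh : IsCoherent A) :
    flatTopology A = .generateFrom (V '' {c : A | IsCompactElement c}) := by
  have := hcoh.isCompactlyGenerated
  refine congrArg TopologicalSpace.generateFrom (Set.ext fun U => ⟨?_, ?_⟩)
  · rintro ⟨hcomp, hopen⟩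
    obtain ⟨c, hc, rfl⟩ := exists_eq_V_of_isCompact_compl hcomp hopen
    exact ⟨c, hc, rfl⟩
  · rintro ⟨c, hc, rfl⟩
    exact ⟨hcoh.isCompact_compl_V hc, isOpen_compl_V c⟩

end FlatTopology

section MinF

theorem minV_mul (a b : A) : minV (a * b) = minV a ∪ minV b :=
  Set.Subset.antisymm (fun p hp => p.2.1.2 a b hp) (Set.union_subset
    (fun _ hp => (mul_le_left a b).trans hp) fun _ hp => (mul_le_right a b).trans hp)

theorem minV_neg {e : A} (he : e ∈ booleanCenter A) : minV (neg e) = (minV e)ᶜ :=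
  Set.ext fun p => p.2.1.neg_le_iff he

theorem _root_.Quantale.IsSemiprime.le_of_minV_subset (hsemi : IsSemiprime A) {c e : A}
    (he : e ∈ booleanCenter A) (h : minV e ⊆ minV c) : c ≤ e := by
  refine (mul_neg_eq_bot_iff_le he).1 (hsemi.eq_bot_of_forall_le fun q hq => ?_)
  by_cases heq : e ≤ q
  · exact (mul_le_left _ _).trans (h (show (⟨q, hq⟩ : MinF A) ∈ minV e from heq))
  · exact (mul_le_right _ _).trans (hq.1.neg_le heq)

theorem _root_.Quantale.IsCoherent.minF_topology_eq_generateFrom (hcoh : IsCoherent A) :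
    (inferInstance : TopologicalSpace (MinF A)) =
      .generateFrom (minV '' {c : A | IsCompactElement c}) := by
  change TopologicalSpace.induced MinF.toSpec (flatTopology A) = _
  rw [hcoh.flatTopology_eq_generateFrom, induced_generateFrom_eq, Set.image_image]
  rfl

theorem _root_.Quantale.IsCoherent.isOpen_minV (hcoh : IsCoherent A) {c : A}
    (hc : IsCompactElement c) : IsOpen (minV c) := by
  have := TopologicalSpace.isOpen_generateFrom_of_mem
    (Set.mem_image_of_mem minV (show c ∈ {c : A | IsCompactElement c} from hc))
  rwa [← hcoh.minF_topology_eq_generateFrom] at this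

theorem _root_.Quantale.IsCoherent.isClopen_minV (hcoh : IsCoherent A) {e : A}
    (he : e ∈ booleanCenter A) : IsClopen (minV e) := by
  have := hcoh.isCompactlyGenerated
  have isOpen_of_mem {f : A} (hf : f ∈ booleanCenter A) : IsOpen (minV f) :=
    hcoh.isOpen_minV (isCompactElement_of_mem_booleanCenter hcoh.top_compact hf)
  refine ⟨⟨?_⟩, isOpen_of_mem he⟩
  rw [← minV_neg he]
  exact isOpen_of_mem (neg_mem_booleanCenter he)

theorem _root_.Quantale.IsCoherent.compactSpace_minF (hcoh : IsCoherent A) :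
    CompactSpace (MinF A) := by
  refine ⟨isCompact_generateFrom hcoh.minF_topology_eq_generateFrom fun P hP hcover => ?_⟩
  by_contra! hcon
  let F : Submonoid A :=
    { carrier := {s | ∃ Q ⊆ P, Q.Finite ∧ minV s ⊆ ⋃₀ Q}
      mul_mem' := by
        rintro s t ⟨Q, hQP, hQ, hsQ⟩ ⟨R, hRP, hR, htR⟩
        refine ⟨Q ∪ R, Set.union_subset hQP hRP, hQ.union hR, ?_⟩
        rw [minV_mul, Set.sUnion_union]
        exact Set.union_subset_union hsQ htR
      one_mem' := ⟨∅, Set.empty_subset P, Set.finite_empty, by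
        simp only [minV_one, Set.empty_subset]⟩ }
  obtain ⟨q, hq, -, hqF⟩ := exists_le_isMPrime_avoiding (S := hcoh.compactSubmonoid ⊓ F) (a := ⊥)
    (fun s hs => hs.1)
    (by
      rintro s ⟨-, Q, hQP, hQ, hsQ⟩ hbot
      exact hcon Q hQP hQ fun p _ => hsQ (hbot.trans bot_le))
  obtain ⟨q', hq', hle⟩ := hq.exists_minSpec_le
  obtain ⟨U, hUP, hU⟩ := hcover (Set.mem_univ (⟨q', hq'⟩ : MinF A))
  obtain ⟨c, hc, rfl⟩ := hP hUP
  exact hqF c ⟨hc, {minV c}, Set.singleton_subset_iff.2 hUP, Set.finite_singleton _,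
    (Set.sUnion_singleton _).ge⟩ (hU.trans hle)

end MinF

section Mp

theorem _root_.Quantale.IsMp.sup_eq_top [IsCoatomic A] (hmp : IsMp A) {p q : A}
    (hp : p ∈ minSpec A) (hq : q ∈ minSpec A) (hne : p ≠ q) : p ⊔ q = ⊤ :=
  sup_eq_top_of_forall_isMPrime fun m hm hpm hqm =>
    hne ((hmp m hm).unique ⟨hp, hpm⟩ ⟨hq, hqm⟩)

theorem _root_.Quantale.IsMp.exists_isOpen_sup_kernel_eq_top (hmp : IsMp A)
    (hcoh : IsCoherent A) {p q : MinF A} (hne : p ≠ q) :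
    ∃ U, IsOpen U ∧ q ∈ U ∧ p.1 ⊔ kernel U = ⊤ := by
  have := hcoh.isCompactlyGenerated
  have := hcoh.isCoatomic
  have hqp : q.1 ⊔ p.1 = ⊤ := hmp.sup_eq_top q.2 p.2 fun h => hne (Subtype.ext h.symm)
  obtain ⟨d, hd, hdq, htop⟩ := exists_compact_le_of_le_sup hcoh.top_compact hqp.ge
  refine ⟨minV d, hcoh.isOpen_minV hd, hdq, top_le_iff.1 ?_⟩
  have hdk : d ≤ kernel (minV d) := le_iInf₂ fun _ hr => hr
  rw [sup_comm]
  exact htop.trans (sup_le_sup_right hdk _)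

theorem _root_.Quantale.IsMp.sup_kernel_eq_top (hmp : IsMp A) (hcoh : IsCoherent A)
    {K : Set (MinF A)} (hK : IsCompact K) {p : MinF A} (hp : p ∉ K) : p.1 ⊔ kernel K = ⊤ := by
  refine hK.induction_on (p := fun s => p.1 ⊔ kernel s = ⊤) (by simp [kernel])
    (fun s t hst h => ?_) (fun s t hs ht => ?_) fun q hq => ?_
  · exact top_le_iff.1 (h.ge.trans (sup_le_sup_left (biInf_mono hst) _))
  · rw [kernel, iInf_union]
    exact top_le_iff.1 ((sup_mul_eq_top hs ht).ge.trans (sup_le_sup_left (mul_le_inf _ _) _))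
  · obtain ⟨U, hU, hqU, h⟩ :=
      hmp.exists_isOpen_sup_kernel_eq_top hcoh (ne_of_mem_of_not_mem hq hp).symm
    exact ⟨U, mem_nhdsWithin_of_mem_nhds (hU.mem_nhds hqU), h⟩

theorem _root_.Quantale.IsMp.t2Space_minF (hmp : IsMp A) (hcoh : IsCoherent A) :
    T2Space (MinF A) := by
  have := hcoh.isCompactlyGenerated
  refine ⟨fun p q hne => ?_⟩
  obtain ⟨U, hU, hqU, hsup⟩ := hmp.exists_isOpen_sup_kernel_eq_top hcoh hne
  obtain ⟨c, hc, hcp, htop⟩ := exists_compact_le_of_le_sup hcoh.top_compact hsup.ge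
  exact ⟨minV c, U, hcoh.isOpen_minV hc, hU, hcp, hqU, Set.disjoint_left.2 fun r hrc hrU =>
    r.2.1.sup_ne_top hrc (kernel_le hrU) (top_le_iff.1 htop)⟩

theorem _root_.Quantale.IsMp.kernel_sup_kernel_compl (hmp : IsMp A) (hcoh : IsCoherent A)
    {U : Set (MinF A)} (hU : IsClopen U) : kernel U ⊔ kernel Uᶜ = ⊤ := by
  have := hcoh.compactSpace_minF
  have := hcoh.isCoatomic
  refine sup_eq_top_of_forall_isMPrime fun m hm hle hle' => ?_
  obtain ⟨p, hp, hpm⟩ := hm.exists_minSpec_le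
  by_cases hpU : (⟨p, hp⟩ : MinF A) ∈ U
  · exact hm.sup_ne_top hpm hle' (hmp.sup_kernel_eq_top hcoh (p := ⟨p, hp⟩)
      hU.compl.isClosed.isCompact (not_not_intro hpU))
  · exact hm.sup_ne_top hpm hle (hmp.sup_kernel_eq_top hcoh (p := ⟨p, hp⟩)
      hU.isClosed.isCompact hpU)

theorem _root_.Quantale.IsMp.exists_eq_minV (hmp : IsMp A) (hcoh : IsCoherent A)
    (hsemi : IsSemiprime A) {U : Set (MinF A)} (hU : IsClopen U) :
    ∃ e ∈ booleanCenter A, U = minV e := by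
  have hsup := hmp.kernel_sup_kernel_compl hcoh hU
  refine ⟨kernel U, ⟨kernel Uᶜ, disjoint_iff.2 (hsemi.kernel_inf_kernel_compl U),
    codisjoint_iff.2 hsup⟩, Set.Subset.antisymm (fun p => kernel_le) fun p hp => ?_⟩
  by_contra hpU
  exact p.2.1.sup_ne_top hp (kernel_le hpU) hsup

theorem _root_.Quantale.IsMp.isTopologicalBasis_minV (hmp : IsMp A) (hcoh : IsCoherent A)
    (hsemi : IsSemiprime A) (hbool : IsBooleanSpace (MinF A)) :
    TopologicalSpace.IsTopologicalBasis
      {U : Set (MinF A) | ∃ e ∈ booleanCenter A, U = minV e} := by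
  obtain ⟨_, _, _⟩ := hbool
  convert isTopologicalBasis_isClopen (X := MinF A) using 1
  ext U
  refine ⟨?_, hmp.exists_eq_minV hcoh hsemi⟩
  rintro ⟨e, he, rfl⟩
  exact hcoh.isClopen_minV he

theorem _root_.Quantale.IsMp.isPure_of_mem_minSpec (hmp : IsMp A) (hcoh : IsCoherent A)
    (hsemi : IsSemiprime A) {p : A} (hp : p ∈ minSpec A) : IsPure p := by
  have := hcoh.isCoatomic
  refine fun c hc hcp => sup_eq_top_of_forall_isMPrime fun m hm hpm hcm => ?_
  obtain ⟨q, hq, hqm, hcq⟩ := hcoh.exists_minSpec_le_not_ge hm hc fun d n h =>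
    (le_neg_iff.2 (hsemi.mul_eq_bot_of_mul_pow_eq_bot h)).trans hcm
  obtain rfl : p = q := (hmp m hm).unique ⟨hp, hpm⟩ ⟨hq, hqm⟩
  exact hcq hcp

end Mp

section Purified

theorem _root_.Quantale.IsPurified.isMp (h : IsPurified A) : IsMp A := by
  intro p hp
  obtain ⟨q, hq, hqp⟩ := IsMPrime.exists_minSpec_le hp
  refine ⟨q, ⟨hq, hqp⟩, ?_⟩
  rintro r ⟨hr, hrp⟩
  by_contra hne
  obtain ⟨e, he, her, heq⟩ := h r hr q hq hne
  exact (IsMPrime.neg_le_iff hp he).1 (heq.trans hqp) (her.trans hrp)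

theorem _root_.Quantale.IsPurified.totallySeparatedSpace (h : IsPurified A)
    (hcoh : IsCoherent A) : TotallySeparatedSpace (MinF A) := by
  refine totallySeparatedSpace_iff_exists_isClopen.2 fun p q hne => ?_
  obtain ⟨e, he, hep, heq⟩ := h p.1 p.2 q.1 q.2 fun h => hne (Subtype.ext h)
  exact ⟨minV e, hcoh.isClopen_minV he, hep, (q.2.1.neg_le_iff he).1 heq⟩

end Purified

section Regular

theorem isRegularElement_of_isTopologicalBasis (hcoh : IsCoherent A) (hsemi : IsSemiprime A)
    (hbasis : TopologicalSpace.IsTopologicalBasis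
      {U : Set (MinF A) | ∃ e ∈ booleanCenter A, U = minV e}) {p : A} (hp : p ∈ minSpec A) :
    IsRegularElement p := by
  have := hcoh.isCompactlyGenerated
  refine isRegularElement_of_le_regularPart (le_iff_compact_le_imp.2 fun c hc hcp => ?_)
  obtain ⟨_, ⟨e, he, rfl⟩, hep, hsub⟩ := hbasis.exists_subset_of_mem_open
    (show (⟨p, hp⟩ : MinF A) ∈ minV c from hcp) (hcoh.isOpen_minV hc)
  exact (hsemi.le_of_minV_subset he hsub).trans (le_regularPart he hep)

theorem _root_.Quantale.IsRegularElement.mem_pierceSpectrum {p : A} (hreg : IsRegularElement p)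
    (hp : IsMPrime p) : p ∈ pierceSpectrum A := by
  refine ⟨⟨hp.1, hreg⟩, ?_⟩
  rintro _ ⟨hne, E, hE, rfl⟩ hpE
  refine sSup_le fun e he => ?_
  by_contra hep
  have hneg : neg e ≤ sSup E := (hp.neg_le hep).trans hpE
  rw [neg_le_iff_sup_eq_top (hE he), sup_eq_right.2 (le_sSup he)] at hneg
  exact hne hneg

theorem minSpec_eq_pierceSpectrum [IsCoatomic A]
    (hreg : ∀ p ∈ minSpec A, IsRegularElement p) : minSpec A = pierceSpectrum A := by
  have hsub : minSpec A ⊆ pierceSpectrum A := fun p hp => (hreg p hp).mem_pierceSpectrum hp.1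
  refine hsub.antisymm fun x hx => ?_
  obtain ⟨m, hm, hxm⟩ := exists_le_isMPrime hx.1.1
  obtain ⟨p, hp, hpm⟩ := hm.exists_minSpec_le
  have hpx : p ≤ x :=
    le_sup_right.trans (hx.2 ⟨hm.sup_ne_top hxm hpm, hx.1.2.sup (hreg p hp)⟩ le_sup_left)
  rwa [((hsub hp).2 hx.1 hpx).antisymm hpx]

theorem _root_.Quantale.IsPure.exists_mul_neg_le_regularPart [IsCompactlyGenerated A]
    (htop : IsCompactElement (⊤ : A)) {a c p : A} (ha : IsPure a) (hc : IsCompactElement c)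
    (hca : c ≤ a) (hp : IsMPrime p) (hreg : IsRegularElement p) :
    ∃ e ∈ booleanCenter A, e ≤ p ∧ c * neg e ≤ regularPart a := by
  by_cases hcp : c ≤ p
  · obtain ⟨e, he, hce, hep⟩ := hreg.exists_mem_booleanCenter hc hcp
    exact ⟨e, he, hep, ((mul_neg_eq_bot_iff_le he).2 hce).trans_le bot_le⟩
  · have hpa : ⊤ ≤ p ⊔ a := by
      rw [← ha c hc hca, sup_comm p]
      exact sup_le_sup_left (hp.neg_le hcp) a
    obtain ⟨d, hd, hdp, hda⟩ := exists_compact_le_of_le_sup htop hpa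
    obtain ⟨e, he, hde, hep⟩ := hreg.exists_mem_booleanCenter hd hdp
    have hea : neg e ≤ a :=
      (neg_le_iff_sup_eq_top he).2 (top_le_iff.1 (hda.trans (sup_le_sup_right hde a)))
    exact ⟨e, he, hep, (mul_le_right _ _).trans (le_regularPart (neg_mem_booleanCenter he) hea)⟩

theorem _root_.Quantale.IsPure.isRegularElement [IsCompactlyGenerated A]
    (htop : IsCompactElement (⊤ : A)) (hreg : ∀ p ∈ minSpec A, IsRegularElement p) {a : A}
    (ha : IsPure a) : IsRegularElement a := by
  have := CompleteLattice.coatomic_of_top_compact htop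
  refine isRegularElement_of_le_regularPart (le_iff_compact_le_imp.2 fun c hc hca => ?_)
  refine le_of_forall_isMPrime_exists_mul_le fun m hm => ?_
  obtain ⟨p, hp, hpm⟩ := hm.exists_minSpec_le
  obtain ⟨e, he, hep, hle⟩ := ha.exists_mul_neg_le_regularPart htop hc hca hp.1 (hreg p hp)
  exact ⟨neg e, fun h => (hm.neg_le_iff he).1 h (hep.trans hpm), hle⟩

end Regular

end IntegralQuantale

theorem theorem7p5 (A : Type*) [CommMonoid A] [CompleteLattice A] [IsQuantale A]
    [Quantale.IsIntegral A] (hcoh : Quantale.IsCoherent A) (hsemi : Quantale.IsSemiprime A) :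
    List.TFAE [
      Quantale.IsPurified A,
      Quantale.IsMp A ∧ TotallySeparatedSpace (Quantale.MinF A),
      Quantale.IsMp A ∧ TotallyDisconnectedSpace (Quantale.MinF A),
      Quantale.IsMp A ∧ Quantale.IsBooleanSpace (Quantale.MinF A),
      TopologicalSpace.IsTopologicalBasis
        {U : Set (Quantale.MinF A) |
          ∃ e ∈ Quantale.booleanCenter A, U = Quantale.MinF.toSpec ⁻¹' Quantale.V e},
      ∀ p ∈ Quantale.minSpec A, Quantale.IsRegularElement p,
      Quantale.minSpec A = Quantale.pierceSpectrum A,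
      Quantale.IsMp A ∧ ∀ a : A, Quantale.IsPure a → Quantale.IsRegularElement a] := by
  have := hcoh.isCompactlyGenerated
  have := hcoh.isCoatomic
  tfae_have 1 → 2 := fun h => ⟨h.isMp, h.totallySeparatedSpace hcoh⟩
  tfae_have 2 → 3 := fun ⟨hmp, _⟩ => ⟨hmp, inferInstance⟩
  tfae_have 3 → 4 := fun ⟨hmp, h⟩ => ⟨hmp, hcoh.compactSpace_minF, hmp.t2Space_minF hcoh, h⟩
  tfae_have 4 → 5 := fun ⟨hmp, h⟩ => hmp.isTopologicalBasis_minV hcoh hsemi h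
  tfae_have 5 → 6 := fun h _ =>
    IntegralQuantale.isRegularElement_of_isTopologicalBasis hcoh hsemi h
  tfae_have 6 → 7 := IntegralQuantale.minSpec_eq_pierceSpectrum
  tfae_have 7 → 6 := fun h p hp => (h.subset hp).1.2
  tfae_have 6 → 1 := IntegralQuantale.isPurified_of_isRegularElement
  tfae_have 6 → 8 := fun h =>
    ⟨(IntegralQuantale.isPurified_of_isRegularElement h).isMp,
      fun _ ha => ha.isRegularElement hcoh.top_compact h⟩
  tfae_have 8 → 6 := fun ⟨hmp, h⟩ p hp => h p (hmp.isPure_of_mem_minSpec hcoh hsemi hp)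
  tfae_finish
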